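/- Let $M=(\mathcal S,\mathcal A,R,P,p_0,\gamma)$ be a Markov decision process: $\mathcal S$ and $\mathcal A$ are standard Borel spaces, $R:\mathcal S\times\mathcal A\times\mathcal S\to[0,\bar R]$ is a measurable bounded reward, $P(\cdot\mid s,a)$ and $p_0$ are probability densities on $\mathcal S$ with respect to a fixed $\sigma$-finite reference measure (with $P(s'\mid s,a)$ jointly measurable), and $0<\gamma<1$. For $s,s'\in\mathcal S$, $a\in\mathcal A$, $y\in\mathbb R$ put $y'=\frac{R(s,a,s')\lor y}{\gamma}$, where $u\lor v=\max\{u,v\}$. The extended max-reward MDP has state space $\mathcal S\times\mathbb R$; from $(s,y)$, under the action $a$, it moves to $(s',y')$, where $s'\sim P(\cdot\mid s,a)$. An extended policy $\hat\pi$ is a Markov kernel $\hat\pi(da\mid s,y)$ from $\mathcal S\times\mathbb R$ to $\mathcal A$. Let $$\hat q^{\hat\pi}(s,a,y)=\mathbb E_{\hat\pi}\Big[y\lor\max_{t\ge0}\gamma^{t}R(s_t,a_t,s_{t+1})\,\Big|\,s_0=s,\ y_0=y,\ a_0=a\Big],\qquad \hat q^\ast(s,a,y)=\sup_{\hat\pi}\hat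 q^{\hat\pi}(s,a,y),$$ and for $q:\mathcal S\times\mathcal A\times\mathbb R\to\mathbb R$ let $$(\hat{\mathcal T}^\ast q)(s,a,y)=\gamma\,\mathbb E_{s'\sim P(\cdot\mid s,a)}\Big[y'\lor\sup_{a'\in\mathcal A}q(s',a',y')\Big].$$ Say that $\hat{\mathcal T}^\ast$ is defined at $q$ if for all $(s,a,y)$ the inner supremum is finite for $P(\cdot\mid s,a)$-almost every $s'$ and the random variable in the brackets is integrable. Let $\|q-z\|_\infty=\sup_{s,a,y}|q(s,a,y)-z(s,a,y)|\in[0,\infty]$. Then: 1. $\hat{\mathcal T}^\ast$ is defined at every measurable $q$ that is bounded on $\mathcal S\times\mathcal A\times[-Y,Y]$ for each $Y$, and $\hat{\mathcal T}^\ast$ is a $\gamma$-contraction in the sup norm: $\|\hat{\mathcal T}^\ast q-\hat{\mathcal T}^\ast z\|_\infty\le\gamma\|q-z\|_\infty$ for all $q,z$ at which it is defined. 2. The supremum $\hat q^\ast$ is finite, $\hat{\mathcal T}^\ast$ is defined at $\hat q^\ast$, and $\hat{\mathcal T}^\ast\hat q^\ast=\hat q^\ast$; moreover $\hat q^\ast$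 is the only fixed point $q$ of $\hat{\mathcal T}^\ast$ with $\|q-\hat q^\ast\|_\infty<\infty$. -/

import Mathlib

open MeasureTheory ProbabilityTheory Set
open scoped ENNReal

/-- A Markov decision process `(𝒮, 𝒜, R, P, p₀, γ)` with state space `S` and action space `A`.
Probability density functions on `S` are taken with respect to the reference measure `ν`
(Lebesgue measure for a Euclidean state space, counting measure for a countable one). -/
structure MDP (S A : Type*) [MeasurableSpace S] [MeasurableSpace A] (ν : Measure S) where
  /-- the reward function `R(s, a, s')`, with values in `[0, Rmax]` -/
  R : S → A → S → ℝ
  Rmax : ℝ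
  measurable_R : Measurable fun x : S × A × S => R x.1 x.2.1 x.2.2
  R_nonneg : ∀ s a s', 0 ≤ R s a s'
  R_le : ∀ s a s', R s a s' ≤ Rmax
  /-- `p s a` is the probability density function of the next state -/
  p : S → A → S → ℝ≥0∞
  measurable_p : Measurable fun x : (S × A) × S => p x.1.1 x.1.2 x.2
  lintegral_p : ∀ s a, ∫⁻ s', p s a s' ∂ν = 1
  /-- the probability density function of the initial state -/
  p₀ : S → ℝ≥0∞
  measurable_p₀ : Measurable p₀
  lintegral_p₀ : ∫⁻ s, p₀ s ∂ν = 1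
  /-- the discount factor -/
  γ : ℝ
  γ_pos : 0 < γ
  γ_lt_one : γ < 1

namespace MDP

variable {S A : Type*} [MeasurableSpace S] [MeasurableSpace A] {ν : Measure S}

/-- `y' = (R(s, a, s') ∨ y) / γ`. -/
noncomputable def nextY (M : MDP S A ν) (s : S) (a : A) (y : ℝ) (s' : S) : ℝ :=
  (M.R s a s' ⊔ y) / M.γ

/-- The transition kernel `P(ds' | s, a)`, with density `p s a` with respect to `ν`. -/
noncomputable def P [SFinite ν] (M : MDP S A ν) : Kernel (S × A) S :=
  Kernel.withDensity (Kernel.const (S × A) ν) fun x s' => M.p x.1 x.2 s'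

theorem P_apply [SFinite ν] (M : MDP S A ν) (x : S × A) :
    M.P x = ν.withDensity (M.p x.1 x.2) := by
  rw [P, Kernel.withDensity_apply _ (by exact M.measurable_p), Kernel.const_apply]

instance [SFinite ν] (M : MDP S A ν) : IsMarkovKernel M.P where
  isProbabilityMeasure x := by
    rw [P_apply]
    exact ⟨by rw [withDensity_apply _ MeasurableSet.univ, Measure.restrict_univ, M.lintegral_p]⟩

/-- The map `((s, y), a), s' ↦ (s', y')` from an extended state, an action and a next state to the
next extended state. -/
noncomputable def extNext (M : MDP S A ν) (x : ((S × ℝ) × A) × S) : S × ℝ :=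
  (x.2, M.nextY x.1.1.1 x.1.2 x.1.1.2 x.2)

theorem measurable_extNext (M : MDP S A ν) : Measurable M.extNext := by
  have h : Measurable fun x : ((S × ℝ) × A) × S => M.R x.1.1.1 x.1.2 x.2 :=
    M.measurable_R.comp
      (measurable_fst.fst.fst.prodMk (measurable_fst.snd.prodMk measurable_snd))
  exact measurable_snd.prodMk ((h.sup measurable_fst.fst.snd).div_const _)

/-- The transition kernel `P̂(ds', dy' | s, y, a)` of the extended max-reward MDP, whose states are
the pairs `(s, y)`: `s'` has law `P(· | s, a)`, and then `y' = (R(s, a, s') ∨ y) / γ`. -/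
noncomputable def extP [SFinite ν] (M : MDP S A ν) : Kernel ((S × ℝ) × A) (S × ℝ) :=
  (Kernel.id ×ₖ M.P.comap (fun x : (S × ℝ) × A => (x.1.1, x.2))
    (measurable_fst.fst.prodMk measurable_snd)).map M.extNext

instance [SFinite ν] (M : MDP S A ν) : IsMarkovKernel M.extP :=
  Kernel.IsMarkovKernel.map _ M.measurable_extNext

variable (S A) in
/-- An extended max-reward policy: a (stochastic, stationary) policy `π̂(da | s, y)` of the extended
max-reward MDP. -/
structure ExtPolicy where
  toKernel : Kernel (S × ℝ) A
  isMarkov : IsMarkovKernel toKernel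

instance (π : ExtPolicy S A) : IsMarkovKernel π.toKernel := π.isMarkov

/-- One step of the process of extended state-action pairs `((s_t, y_t), a_t)` under `π`: the next
extended state has law `extP`, and the next action is drawn from `π` there. -/
noncomputable def step [SFinite ν] (M : MDP S A ν) (π : ExtPolicy S A) :
    Kernel ((S × ℝ) × A) ((S × ℝ) × A) :=
  M.extP ⊗ₖ π.toKernel.comap Prod.snd measurable_snd

instance [SFinite ν] (M : MDP S A ν) (π : ExtPolicy S A) : IsMarkovKernel (M.step π) := by
  unfold step; infer_instance

/-- The law of the whole trajectory `(((s_t, y_t), a_t))_{t ≥ 0}` under `π`, given that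
`((s_0, y_0), a_0) = z`. -/
noncomputable def law [SFinite ν] (M : MDP S A ν) (π : ExtPolicy S A) (z : (S × ℝ) × A) :
    Measure (ℕ → (S × ℝ) × A) :=
  Kernel.traj (X := fun _ => (S × ℝ) × A)
    (fun n => (M.step π).comap (fun h : (i : Finset.Iic n) → (S × ℝ) × A =>
      h ⟨n, Finset.mem_Iic.2 le_rfl⟩) (measurable_pi_apply _)) 0 (fun _ => z)

/-- The max-reward return `max {r_1, γ r_2, γ² r_3, …}` of a trajectory, where
`r_{t+1} = R(s_t, a_t, s_{t+1})`. (Rewards are bounded, so the supremum is finite.) -/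
noncomputable def maxReturn (M : MDP S A ν) (ω : ℕ → (S × ℝ) × A) : ℝ :=
  ⨆ t : ℕ, M.γ ^ t * M.R (ω t).1.1 (ω t).2 (ω (t + 1)).1.1

/-- The max-reward state-action value function of the extended policy `π`:
the expectation of `y ∨ Ĝ` given that the extended state is `(s, y)` and the action is `a`. -/
noncomputable def qPolicy [SFinite ν] (M : MDP S A ν) (π : ExtPolicy S A) (s : S) (a : A) (y : ℝ) :
    ℝ :=
  ∫ ω, (y ⊔ M.maxReturn ω) ∂(M.law π ((s, y), a))

/-- The optimal max-reward state-action value function. -/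
noncomputable def qStar [SFinite ν] (M : MDP S A ν) (s : S) (a : A) (y : ℝ) : ℝ :=
  ⨆ π : ExtPolicy S A, M.qPolicy π s a y

/-- The max-reward Bellman optimality operator. -/
noncomputable def bellmanOpt [SFinite ν] (M : MDP S A ν) (q : S → A → ℝ → ℝ) (s : S) (a : A)
    (y : ℝ) : ℝ :=
  M.γ * ∫ s', (M.nextY s a y s' ⊔ ⨆ a', q s' a' (M.nextY s a y s')) ∂(M.P (s, a))

/-- The formula that defines `bellmanOpt q` makes sense at every point: almost surely the supremum
over the next action is finite, and the random variable has an expectation. -/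
def InDomain [SFinite ν] (M : MDP S A ν) (q : S → A → ℝ → ℝ) : Prop :=
  ∀ s a y,
    (∀ᵐ s' ∂(M.P (s, a)), BddAbove (range fun a' => q s' a' (M.nextY s a y s'))) ∧
    Integrable (fun s' => M.nextY s a y s' ⊔ ⨆ a', q s' a' (M.nextY s a y s')) (M.P (s, a))

end MDP

/-- The distance `‖q - z‖_∞` in the supremum norm, with values in `[0, ∞]`. -/
noncomputable def supDist {S A : Type*} (q z : S → A → ℝ → ℝ) : ℝ≥0∞ :=
  ⨆ (s : S) (a : A) (y : ℝ), edist (q s a y) (z s a y)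

/-! The contraction estimate is soft: `max`, suprema and averages are 1-Lipschitz, and the outer
factor `γ` remains. It gives uniqueness at finite distance. The work is to show that `qStar` is a
fixed point.

Measurability of `qStar` is not evident from its definition, so a fixed point `V` is built
independently by value iteration in the class `Admissible` and then identified with `qStar`. Along a
trajectory `γ ^ n * yₙ` is the maximum of `y₀` and the first `n` discounted rewards, so it increases
to `y₀ ∨ maxReturn` (`isLUB_discounted`). Since `y ∨ 0 ≤ V ≤ y ∨ Rmax`, the quantity `γ ^ n * V` at
time `n` has the same limit. By the fixed-point equation its expectation never increases under any
policy, so `qPolicy ≤ V`; under an `ε`-greedy policy it drops by at most `ε * γ ^ n` at step `n`, so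
`V - ε / (1 - γ) ≤ qPolicy`.

A supremum over actions of a Borel function need not be Borel. Almost everywhere it is a countable
supremum along measurable selections (Jankov, von Neumann). One null set serves every transition
because `P ≪ ν`, and every `y` because admissible functions are Lipschitz in `y`. -/

/-! ### Measurable selection -/

open Filter Topology in
/-- The image of the Baire space under a continuous map is approximated in measure from inside by
images of compact sets. -/
theorem exists_isCompact_measure_range_le {X : Type*} [TopologicalSpace X] [T2Space X]
    [MeasurableSpace X] [BorelSpace X] (μ : Measure X) [IsFiniteMeasure μ] {f : (ℕ → ℕ) → X}
    (hf : Continuous f) {ε : ℝ≥0∞} (hε : ε ≠ 0) :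
    ∃ K : Set (ℕ → ℕ), IsCompact K ∧ μ (range f) ≤ μ (f '' K) + ε := by
  obtain ⟨δ, hδ0, hδ⟩ := ENNReal.exists_pos_sum_of_countable' hε ℕ
  have hstep : ∀ (T : Set (ℕ → ℕ)) (k : ℕ),
      ∃ m, μ (f '' T) ≤ μ (f '' (T ∩ {x | x k ≤ m})) + δ k := by
    intro T k
    by_cases h0 : μ (f '' T) = 0
    · exact ⟨0, by simp [h0]⟩
    have hU : f '' T = ⋃ m, f '' (T ∩ {x | x k ≤ m}) := by
      rw [← image_iUnion, ← inter_iUnion]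
      congr 1
      refine (inter_eq_left.2 fun x _ => mem_iUnion.2 ⟨x k, by simp⟩).symm
    have hmono : Monotone fun m => f '' (T ∩ {x | x k ≤ m}) := fun m m' h =>
      image_mono (inter_subset_inter_right _ (ofPred_subset_ofPred.2 fun x hx => le_trans hx h))
    -- Continuity from below holds for arbitrary increasing sets, so the images need not be
    -- measurable.
    have hlim := tendsto_measure_iUnion_atTop (μ := μ) hmono
    rw [← hU] at hlim
    have hlt : μ (f '' T) - δ k < μ (f '' T) :=
      ENNReal.sub_lt_self (measure_ne_top _ _) h0 (hδ0 k).ne'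
    obtain ⟨m, hm⟩ := (hlim.eventually (lt_mem_nhds hlt)).exists
    exact ⟨m, tsub_le_iff_right.1 hm.le⟩
  choose m hm using hstep
  let T : ℕ → Set (ℕ → ℕ) := fun n => Nat.rec univ (fun k T => T ∩ {x | x k ≤ m T k}) n
  have hT : ∀ k, T (k + 1) = T k ∩ {x | x k ≤ m (T k) k} := fun _ => rfl
  let b : ℕ → ℕ := fun k => m (T k) k
  have hTb : ∀ k, T k = {x | ∀ i < k, x i ≤ b i} := by
    intro k
    induction k with
    | zero => simp [T]
    | succ k ih =>
      rw [hT]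
      ext x
      have : x ∈ T k ↔ ∀ i < k, x i ≤ b i := by rw [ih]; rfl
      simp only [mem_inter_iff, this, mem_ofPred_eq, Nat.lt_succ_iff_lt_or_eq]
      constructor
      · rintro ⟨h1, h2⟩ i (hi | rfl)
        exacts [h1 i hi, h2]
      · exact fun h => ⟨fun i hi => h i (.inl hi), h k (.inr rfl)⟩
  have hμT : ∀ k, μ (range f) ≤ μ (f '' T k) + ∑ i ∈ Finset.range k, δ i := by
    intro k
    induction k with
    | zero => simp [T]
    | succ k ih =>
      rw [Finset.sum_range_succ, hT]
      calc _ ≤ _ := ih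
        _ ≤ (μ (f '' (T k ∩ {x | x k ≤ m (T k) k})) + δ k) + ∑ i ∈ Finset.range k, δ i := by
            gcongr; exact hm _ _
        _ = _ := by ring
  let K : Set (ℕ → ℕ) := {x | ∀ i, x i ≤ b i}
  have hK : IsCompact K := by
    have : K = univ.pi fun i => Iic (b i) := by ext x; simp [K, Pi.le_def]
    rw [this]
    exact isCompact_univ_pi fun i => (finite_Iic _).isCompact
  refine ⟨K, hK, ?_⟩
  -- Closures are taken because continuity from above does need measurability; compactness of `K`
  -- ensures that they add nothing in the limit.
  have hsub : ⋂ k, closure (f '' T k) ⊆ f '' K := by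
    intro s hs
    by_contra hsK
    obtain ⟨U, V, hU, hV, hKU, hsV, hUV⟩ :=
      SeparatedNhds.of_isCompact_isCompact (hK.image hf) (isCompact_singleton (x := s))
        (disjoint_singleton_right.2 hsK)
    have hk : ∃ k, f '' T k ⊆ U := by
      by_contra! hcon
      have : ∀ k, ∃ x ∈ T k, f x ∉ U := by
        intro k
        obtain ⟨_, ⟨x, hx, rfl⟩, hxU⟩ := not_subset.1 (hcon k)
        exact ⟨x, hx, hxU⟩
      choose x hxT hxU using this
      -- `x k` obeys the bounds only in its first `k` coordinates. Zeroing the others puts it in `K`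
      -- without affecting coordinatewise limits.
      have hxK : ∀ k, (fun i => if i < k then x k i else 0) ∈ K := by
        intro k i
        have := hxT k
        rw [hTb] at this
        by_cases hi : i < k
        · simpa [hi] using this i hi
        · simp [hi]
      obtain ⟨z, hz, φ, hφ, hlim⟩ := hK.tendsto_subseq hxK
      have hlim' : Tendsto (fun n => x (φ n)) atTop (𝓝 z) := by
        rw [tendsto_pi_nhds] at hlim ⊢
        intro i
        refine (hlim i).congr' ?_
        filter_upwards [hφ.tendsto_atTop.eventually (eventually_gt_atTop i)] with n hn
        simp [hn]
      have := ((hf.tendsto z).comp hlim').eventually (hU.mem_nhds (hKU (mem_image_of_mem f hz)))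
      obtain ⟨n, hn⟩ := this.exists
      exact hxU _ hn
    obtain ⟨k, hk⟩ := hk
    have h1 : s ∈ closure U := closure_mono hk (mem_iInter.1 hs k)
    obtain ⟨t, htV, htU⟩ := mem_closure_iff.1 h1 V hV (hsV rfl)
    exact disjoint_left.1 hUV htU htV
  have hanti : Antitone fun k => closure (f '' T k) :=
    antitone_nat_of_succ_le fun k => closure_mono (image_mono (hT k ▸ inter_subset_left))
  have hlim := tendsto_measure_iInter_atTop (μ := μ)
    (fun k => (isClosed_closure (s := f '' T k)).measurableSet.nullMeasurableSet) hanti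
    ⟨0, measure_ne_top _ _⟩
  have hge : μ (range f) ≤ μ (⋂ k, closure (f '' T k)) + ε := by
    refine ge_of_tendsto' (hlim.add_const ε) fun k => (hμT k).trans ?_
    refine add_le_add (measure_mono subset_closure) ?_
    · exact (ENNReal.sum_le_tsum _).trans hδ.le
  exact hge.trans (by gcongr)

/-- A compact subset of `S × ℝ` has a measurable section. -/
theorem IsCompact.exists_measurable_section {S : Type*} [TopologicalSpace S] [T2Space S]
    [MeasurableSpace S] [BorelSpace S] {Q : Set (S × ℝ)} (hQ : IsCompact Q) :
    ∃ u : S → ℝ, Measurable u ∧ ∀ s ∈ Prod.fst '' Q, (s, u s) ∈ Q := by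
  have hsec : ∀ s, IsCompact (Prod.mk s ⁻¹' Q) := by
    intro s
    have : Prod.mk s ⁻¹' Q = Prod.snd '' (Q ∩ Prod.fst ⁻¹' {s}) := by
      ext a
      simp
    rw [this]
    exact (hQ.inter_right (isClosed_singleton.preimage continuous_fst)).image continuous_snd
  have hmem : ∀ s ∈ Prod.fst '' Q, sInf (Prod.mk s ⁻¹' Q) ∈ Prod.mk s ⁻¹' Q := by
    rintro _ ⟨⟨s, a⟩, h, rfl⟩
    exact (hsec s).sInf_mem ⟨a, h⟩
  refine ⟨fun s => sInf (Prod.mk s ⁻¹' Q), measurable_of_Iic fun c => ?_, hmem⟩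
  have hm : MeasurableSet (Prod.fst '' Q) := (hQ.image continuous_fst).measurableSet
  have hc : MeasurableSet (Prod.fst '' (Q ∩ Prod.snd ⁻¹' Iic c)) :=
    ((hQ.inter_right (isClosed_Iic.preimage continuous_snd)).image continuous_fst).measurableSet
  -- Off the projection the fibre is empty and `sInf ∅ = 0`, whence the second piece.
  have : (fun s => sInf (Prod.mk s ⁻¹' Q)) ⁻¹' Iic c =
      Prod.fst '' (Q ∩ Prod.snd ⁻¹' Iic c) ∪ ((Prod.fst '' Q)ᶜ ∩ {_s | (0 : ℝ) ≤ c}) := by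
    ext s
    by_cases hs : s ∈ Prod.fst '' Q
    · simp only [mem_preimage, mem_Iic, mem_union, mem_inter_iff, mem_compl_iff, hs,
        not_true_eq_false, false_and, or_false]
      constructor
      · exact fun h => ⟨(s, _), ⟨hmem s hs, h⟩, rfl⟩
      · rintro ⟨⟨s, a⟩, ⟨h1, h2⟩, rfl⟩
        exact (csInf_le (hsec s).bddBelow h1).trans h2
    · have h0 : Prod.mk s ⁻¹' Q = ∅ := by
        ext a
        simp only [mem_preimage, mem_empty_iff_false, iff_false]
        exact fun h => hs ⟨_, h, rfl⟩
      have h1 : s ∉ Prod.fst '' (Q ∩ Prod.snd ⁻¹' Iic c) := fun h =>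
        hs (image_mono inter_subset_left h)
      simp only [mem_preimage, h0, Real.sInf_empty, mem_Iic, mem_union, h1, false_or,
        mem_inter_iff, mem_compl_iff, hs, not_false_eq_true, true_and, mem_ofPred_eq]
  rw [this]
  exact hc.union (hm.compl.inter (MeasurableSet.const _))

/-- A measurable subset of `S × A` has a section which is measurable and defined almost
everywhere on its projection (Jankov, von Neumann). -/
theorem MeasurableSet.exists_measurable_section_ae {S A : Type*} [MeasurableSpace S]
    [StandardBorelSpace S] [MeasurableSpace A] [StandardBorelSpace A] [Nonempty A]
    (μ : Measure S) [SFinite μ] {B : Set (S × A)} (hB : MeasurableSet B) :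
    ∃ g : S → A, Measurable g ∧ ∀ᵐ s ∂μ, ∀ a, (s, a) ∈ B → (s, g s) ∈ B := by
  let := upgradeStandardBorel S
  rw [← ae_toFinite]
  have he := measurableEmbedding_embeddingReal A
  obtain ⟨inv, hinv, hinve⟩ := he.exists_measurable_extend (g := id) measurable_id
    fun _ => ‹Nonempty A›
  have hpe : MeasurableEmbedding (Prod.map (id : S → S) (embeddingReal A)) :=
    MeasurableEmbedding.id.prodMap he
  have hB' : MeasurableSet (Prod.map (id : S → S) (embeddingReal A) '' B) :=
    hpe.measurableSet_image.2 hB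
  set B' := Prod.map (id : S → S) (embeddingReal A) '' B
  -- With `A` embedded in `ℝ`, the Borel set `B'` is a continuous image of the Baire space unless
  -- empty, so compact subsets exhaust its projection in measure.
  have hcap : ∀ n : ℕ, ∃ Q ⊆ B', IsCompact Q ∧
      μ.toFinite (Prod.fst '' B') ≤ μ.toFinite (Prod.fst '' Q) + ((n : ℝ≥0∞) + 1)⁻¹ := by
    intro n
    have han := hB'.analyticSet
    rw [AnalyticSet] at han
    rcases han with h0 | ⟨F, hF, hFr⟩
    · exact ⟨∅, empty_subset _, isCompact_empty, by simp [h0]⟩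
    · obtain ⟨K, hK, hle⟩ := exists_isCompact_measure_range_le μ.toFinite
        (continuous_fst.comp hF) (ε := ((n : ℝ≥0∞) + 1)⁻¹) (by simp)
      refine ⟨F '' K, hFr ▸ image_subset_range _ _, hK.image hF, ?_⟩
      rw [← hFr, ← range_comp, ← image_comp]
      exact hle
  choose Q hQB hQ hQμ using hcap
  have hQm : ∀ n, MeasurableSet (Prod.fst '' Q n) := fun n =>
    ((hQ n).image continuous_fst).measurableSet
  have hae : (⋃ n, Prod.fst '' Q n : Set S) =ᵐ[μ.toFinite] Prod.fst '' B' := by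
    refine ae_eq_of_subset_of_measure_ge (iUnion_subset fun n => image_mono (hQB n)) ?_
      (MeasurableSet.iUnion hQm).nullMeasurableSet (measure_ne_top _ _)
    have hlim : Filter.Tendsto (fun n : ℕ => ((n : ℝ≥0∞) + 1)⁻¹) Filter.atTop (nhds 0) := by
      have := (ENNReal.tendsto_inv_nat_nhds_zero).comp (Filter.tendsto_add_atTop_nat 1)
      refine this.congr fun n => by simp
    refine ge_of_tendsto' (by simpa using hlim.const_add (μ.toFinite (⋃ n, Prod.fst '' Q n)))
      fun n => (hQμ n).trans ?_
    gcongr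
    exact subset_iUnion (fun n => Prod.fst '' Q n) n
  choose u hu huQ using fun n => (hQ n).exists_measurable_section
  -- The second alternative makes `Nat.find` total.
  let p : ℕ → S → Prop := fun n s => s ∈ Prod.fst '' Q n ∨ s ∉ ⋃ n, Prod.fst '' Q n
  have hpm : ∀ n, MeasurableSet {s | p n s} := fun n =>
    (hQm n).union (MeasurableSet.iUnion hQm).compl
  have hp : ∀ s, ∃ n, p n s := by
    intro s
    by_cases hs : s ∈ ⋃ n, Prod.fst '' Q n
    · obtain ⟨n, hn⟩ := mem_iUnion.1 hs
      exact ⟨n, .inl hn⟩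
    · exact ⟨0, .inr hs⟩
  classical
  refine ⟨fun s => inv (u (Nat.find (hp s)) s), hinv.comp (Measurable.find hu hpm hp), ?_⟩
  filter_upwards [hae.mem_iff] with s hs a ha
  have hsU : s ∈ ⋃ n, Prod.fst '' Q n :=
    hs.2 ⟨(s, embeddingReal A a), mem_image_of_mem (Prod.map id (embeddingReal A)) ha, rfl⟩
  have h1 : s ∈ Prod.fst '' Q (Nat.find (hp s)) :=
    (Nat.find_spec (hp s)).resolve_right (not_not.2 hsU)
  obtain ⟨⟨s', a'⟩, hb, heq⟩ := hQB _ (huQ _ s h1)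
  simp only [Prod.map_apply, id_eq, Prod.mk.injEq] at heq
  obtain ⟨rfl, h2⟩ := heq
  have : inv (embeddingReal A a') = a' := congrFun hinve a'
  rw [← h2, this]
  exact hb

/-- For a measurable function of `(s, a)` the supremum over `a` is almost everywhere approached
along countably many measurable selections. -/
theorem Measurable.exists_selections_ae {S A : Type*} [MeasurableSpace S]
    [StandardBorelSpace S] [MeasurableSpace A] [StandardBorelSpace A] [Nonempty A]
    (μ : Measure S) [SFinite μ] {f : S × A → ℝ} (hf : Measurable f) :
    ∃ g : ℚ → S → A, (∀ i, Measurable (g i)) ∧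
      ∀ᵐ s ∂μ, ∀ a, ∀ c < f (s, a), ∃ i, c < f (s, g i s) := by
  choose g hg hgae using fun r : ℚ =>
    (measurableSet_lt (measurable_const (a := (r : ℝ))) hf).exists_measurable_section_ae μ
  refine ⟨g, hg, ?_⟩
  filter_upwards [ae_all_iff.2 hgae] with s hs a c hc
  obtain ⟨r, hr1, hr2⟩ := exists_rat_btwn hc
  exact ⟨r, hr1.trans (hs r a hr2)⟩

/-- A version of `Measurable.exists_selections_ae` with a parameter `y` in which the function is
Lipschitz, where the selections and the null set do not depend on `y`. -/
theorem exists_selections_ae_of_lipschitz {S A : Type*} [MeasurableSpace S]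
    [StandardBorelSpace S] [MeasurableSpace A] [StandardBorelSpace A] [Nonempty A]
    (μ : Measure S) [SFinite μ] {q : S → A → ℝ → ℝ}
    (hq : Measurable fun x : S × A × ℝ => q x.1 x.2.1 x.2.2)
    (hlip : ∀ s a y y', |q s a y - q s a y'| ≤ |y - y'|) :
    ∃ g : ℕ → S → A, (∀ i, Measurable (g i)) ∧
      ∀ᵐ s ∂μ, ∀ y a, ∀ c < q s a y, ∃ i, c < q s (g i s) y := by
  have hqr : ∀ r : ℚ, Measurable fun x : S × A => q x.1 x.2 r := fun r =>
    hq.comp (measurable_fst.prodMk (measurable_snd.prodMk measurable_const))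
  choose g hg hgae using fun r : ℚ => (hqr r).exists_selections_ae μ
  obtain ⟨φ, hφ⟩ := exists_surjective_nat (ℚ × ℚ)
  refine ⟨fun n => g (φ n).1 (φ n).2, fun n => hg _ _, ?_⟩
  filter_upwards [ae_all_iff.2 hgae] with s hs y a c hc
  -- Passing from `y` to the rational `r` and back costs less than a third of the gap each time.
  obtain ⟨r, hr1, hr2⟩ := exists_rat_btwn (show y < y + (q s a y - c) / 3 by linarith)
  have hyr : |y - r| < (q s a y - c) / 3 := by rw [abs_sub_lt_iff]; constructor <;> linarith
  have h1 := abs_le.1 (hlip s a y r)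
  obtain ⟨i, hi⟩ := hs r a (c + (q s a y - c) / 3) (by linarith [h1.2])
  obtain ⟨n, hn⟩ := hφ (r, i)
  refine ⟨n, ?_⟩
  simp only [hn]
  have h2 := abs_le.1 (hlip s (g r i s) y r)
  linarith [h2.1]

theorem abs_ciSup_sub_ciSup_le {ι : Type*} [Nonempty ι] {f g : ι → ℝ} {D : ℝ}
    (hf : BddAbove (range f)) (hg : BddAbove (range g)) (h : ∀ i, |f i - g i| ≤ D) :
    |(⨆ i, f i) - ⨆ i, g i| ≤ D := by
  rw [abs_sub_le_iff, sub_le_iff_le_add, sub_le_iff_le_add]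
  constructor
  · exact ciSup_le fun i => by linarith [(abs_le.1 (h i)).2, le_ciSup hg i]
  · exact ciSup_le fun i => by linarith [(abs_le.1 (h i)).1, le_ciSup hf i]

theorem ciSup_comp_eq_of_forall_lt {ι κ : Type*} [Nonempty ι] [Nonempty κ] {f : ι → ℝ} {g : κ → ι}
    (hf : BddAbove (range f)) (h : ∀ i, ∀ c < f i, ∃ k, c < f (g k)) :
    ⨆ k, f (g k) = ⨆ i, f i := by
  have hfg : BddAbove (range fun k => f (g k)) := hf.mono (range_comp_subset_range g f)
  refine le_antisymm (ciSup_le fun k => le_ciSup hf _) (ciSup_le fun i => ?_)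
  refine le_of_forall_lt fun c hc => ?_
  obtain ⟨k, hk⟩ := h i c hc
  exact hk.trans_le (le_ciSup hfg k)

theorem abs_integral_sub_integral_le {α : Type*} [MeasurableSpace α] {μ : Measure α}
    [IsProbabilityMeasure μ] {f g : α → ℝ} {D : ℝ} (hf : Integrable f μ) (hg : Integrable g μ)
    (h : ∀ᵐ x ∂μ, |f x - g x| ≤ D) : |∫ x, f x ∂μ - ∫ x, g x ∂μ| ≤ D := by
  rw [← integral_sub hf hg, ← Real.norm_eq_abs]
  simpa using norm_integral_le_of_norm_le_const (μ := μ) (f := fun x => f x - g x) (C := D)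
    (by simpa using h)

/-! ### The Bellman operator: domain and contraction -/

namespace MDP

variable {S A : Type*} [MeasurableSpace S] [MeasurableSpace A] {ν : Measure S}

section Basic

variable (M : MDP S A ν)

theorem measurable_nextY :
    Measurable fun x : (S × A × ℝ) × S => M.nextY x.1.1 x.1.2.1 x.1.2.2 x.2 := by
  have h : Measurable fun x : (S × A × ℝ) × S => M.R x.1.1 x.1.2.1 x.2 :=
    M.measurable_R.comp
      (measurable_fst.fst.prodMk (measurable_fst.snd.fst.prodMk measurable_snd))
  exact (h.sup measurable_fst.snd.snd).div_const _

theorem measurable_nextY_right (s : S) (a : A) (y : ℝ) : Measurable (M.nextY s a y) :=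
  M.measurable_nextY.comp (measurable_const (a := (s, a, y)) |>.prodMk measurable_id)

theorem gamma_mul_nextY (s : S) (a : A) (y : ℝ) (s' : S) :
    M.γ * M.nextY s a y s' = M.R s a s' ⊔ y := by
  rw [nextY, mul_div_cancel₀ _ M.γ_pos.ne']

theorem abs_reward_sup_le (s : S) (a : A) (y : ℝ) (s' : S) :
    |M.R s a s' ⊔ y| ≤ M.Rmax ⊔ |y| := by
  refine (abs_max_le_max_abs_abs).trans (max_le_max ?_ le_rfl)
  rw [abs_of_nonneg (M.R_nonneg ..)]
  exact M.R_le ..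

theorem abs_nextY_le (s : S) (a : A) (y : ℝ) (s' : S) :
    |M.nextY s a y s'| ≤ (M.Rmax ⊔ |y|) / M.γ := by
  rw [nextY, abs_div, abs_of_pos M.γ_pos]
  exact div_le_div_of_nonneg_right (M.abs_reward_sup_le s a y s') M.γ_pos.le

theorem abs_nextY_sub_le (s : S) (a : A) (y y' : ℝ) (s' : S) :
    |M.nextY s a y s' - M.nextY s a y' s'| ≤ |y - y'| / M.γ := by
  rw [nextY, nextY, ← sub_div, abs_div, abs_of_pos M.γ_pos]
  refine div_le_div_of_nonneg_right ?_ M.γ_pos.le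
  simpa using abs_max_sub_max_le_max (M.R s a s') y (M.R s a s') y'

theorem Rmax_nonneg (s : S) (a : A) : 0 ≤ M.Rmax := (M.R_nonneg s a s).trans (M.R_le s a s)

theorem measurable_mk_nextY (s : S) (a : A) (y : ℝ) :
    Measurable fun s' => (s', M.nextY s a y s') :=
  measurable_id.prodMk (M.measurable_nextY_right s a y)

theorem measurable_nextY_pair : Measurable fun x : ((S × ℝ) × A) × ((S × ℝ) × A) =>
    M.nextY x.1.1.1 x.1.2 x.1.1.2 x.2.1.1 :=
  M.measurable_nextY.comp ((measurable_fst.fst.fst.prodMk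
    (measurable_fst.snd.prodMk measurable_fst.fst.snd)).prodMk measurable_snd.fst.fst)

variable [SFinite ν]

theorem P_absolutelyContinuous (x : S × A) : M.P x ≪ ν := by
  rw [P_apply]
  exact withDensity_absolutelyContinuous _ _

theorem inDomain_of_measurable [StandardBorelSpace S] [StandardBorelSpace A]
    {q : S → A → ℝ → ℝ} (hq : Measurable fun x : S × A × ℝ => q x.1 x.2.1 x.2.2)
    (hb : ∀ Y : ℝ, ∃ C : ℝ, ∀ s a y, |y| ≤ Y → |q s a y| ≤ C) : M.InDomain q := by
  intro s a y
  have : Nonempty A := ⟨a⟩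
  obtain ⟨C, hC⟩ := hb ((M.Rmax ⊔ |y|) / M.γ)
  have hqC : ∀ s' a', |q s' a' (M.nextY s a y s')| ≤ C := fun s' a' =>
    hC _ _ _ (M.abs_nextY_le s a y s')
  have hbdd : ∀ s', BddAbove (range fun a' => q s' a' (M.nextY s a y s')) := fun s' =>
    ⟨C, forall_mem_range.2 fun a' => (abs_le.1 (hqC s' a')).2⟩
  have hf : Measurable fun x : S × A => q x.1 x.2 (M.nextY s a y x.1) :=
    hq.comp (measurable_fst.prodMk
      (measurable_snd.prodMk ((M.measurable_nextY_right s a y).comp measurable_fst)))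
  obtain ⟨g, hg, hae⟩ := hf.exists_selections_ae (M.P (s, a))
  have hsup : AEMeasurable (fun s' => ⨆ a', q s' a' (M.nextY s a y s')) (M.P (s, a)) := by
    refine ⟨fun s' => ⨆ i, q s' (g i s') (M.nextY s a y s'),
      Measurable.iSup fun i => hf.comp (measurable_id.prodMk (hg i)), ?_⟩
    filter_upwards [hae] with s' hs'
    exact (ciSup_comp_eq_of_forall_lt (g := fun i => g i s') (hbdd s') hs').symm
  refine ⟨.of_forall hbdd, ?_⟩
  refine Integrable.of_bound
    ((M.measurable_nextY_right s a y).aemeasurable.sup hsup).aestronglyMeasurable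
    ((M.Rmax ⊔ |y|) / M.γ ⊔ C) (.of_forall fun s' => ?_)
  refine (abs_max_le_max_abs_abs).trans (max_le_max (M.abs_nextY_le s a y s') ?_)
  refine abs_le.2 ⟨?_, ciSup_le fun a' => (abs_le.1 (hqC s' a')).2⟩
  exact (abs_le.1 (hqC s' a)).1.trans (le_ciSup (hbdd s') a)

variable {M}

theorem InDomain.abs_bellmanOpt_sub_le {q z : S → A → ℝ → ℝ} (hq : M.InDomain q)
    (hz : M.InDomain z) {D : ℝ} (hD : ∀ s a y, |q s a y - z s a y| ≤ D) (s : S) (a : A) (y : ℝ) :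
    |M.bellmanOpt q s a y - M.bellmanOpt z s a y| ≤ M.γ * D := by
  have : Nonempty A := ⟨a⟩
  rw [bellmanOpt, bellmanOpt, ← mul_sub, abs_mul, abs_of_pos M.γ_pos]
  refine mul_le_mul_of_nonneg_left ?_ M.γ_pos.le
  refine abs_integral_sub_integral_le (hq s a y).2 (hz s a y).2 ?_
  filter_upwards [(hq s a y).1, (hz s a y).1] with s' h1 h2
  refine (abs_max_sub_max_le_max _ _ _ _).trans (max_le ?_ ?_)
  · simpa using (abs_nonneg _).trans (hD s a y)
  · exact abs_ciSup_sub_ciSup_le h1 h2 fun a' => hD _ _ _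

theorem abs_sub_le_supDist_toReal {S A : Type*} {q z : S → A → ℝ → ℝ} (h : supDist q z ≠ ⊤)
    (s : S) (a : A) (y : ℝ) : |q s a y - z s a y| ≤ (supDist q z).toReal := by
  rw [← Real.dist_eq, dist_edist]
  refine ENNReal.toReal_mono h ?_
  exact le_iSup_of_le s (le_iSup_of_le a (le_iSup_of_le y le_rfl))

theorem InDomain.supDist_bellmanOpt_le {q z : S → A → ℝ → ℝ} (hq : M.InDomain q)
    (hz : M.InDomain z) :
    supDist (M.bellmanOpt q) (M.bellmanOpt z) ≤ ENNReal.ofReal M.γ * supDist q z := by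
  by_cases h : supDist q z = ⊤
  -- Positivity of `γ` matters here, since `0 * ⊤ = 0`.
  · rw [h, ENNReal.mul_top (by simpa using M.γ_pos)]
    exact le_top
  refine iSup_le fun s => iSup_le fun a => iSup_le fun y => ?_
  rw [edist_dist, ← ENNReal.ofReal_toReal h, ← ENNReal.ofReal_mul M.γ_pos.le]
  exact ENNReal.ofReal_le_ofReal
    (hq.abs_bellmanOpt_sub_le hz (abs_sub_le_supDist_toReal h) s a y)

theorem InDomain.eq_of_bellmanOpt_eq {q z : S → A → ℝ → ℝ} (hq : M.InDomain q)
    (hz : M.InDomain z) (hqT : M.bellmanOpt q = q) (hzT : M.bellmanOpt z = z)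
    (h : supDist q z < ⊤) : q = z := by
  have hle := hq.supDist_bellmanOpt_le hz
  rw [hqT, hzT] at hle
  have h0 : supDist q z = 0 := by
    by_contra hne
    have hlt : ENNReal.ofReal M.γ * supDist q z < 1 * supDist q z :=
      ENNReal.mul_lt_mul_left hne h.ne (by simpa using M.γ_lt_one)
    rw [one_mul] at hlt
    exact hle.not_gt hlt
  funext s a y
  have := abs_sub_le_supDist_toReal h.ne s a y
  rw [h0, ENNReal.toReal_zero] at this
  exact sub_eq_zero.1 (abs_eq_zero.1 (this.antisymm (abs_nonneg _)))

end Basic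

/-! ### Admissible functions and value iteration -/

/-- The class of jointly measurable functions which are `1`-Lipschitz in `y` and lie between
`y ∨ 0` and `y ∨ Rmax`. -/
structure Admissible (M : MDP S A ν) (q : S → A → ℝ → ℝ) : Prop where
  measurable : Measurable fun x : S × A × ℝ => q x.1 x.2.1 x.2.2
  lipschitz : ∀ s a y y', |q s a y - q s a y'| ≤ |y - y'|
  lower : ∀ s a y, y ⊔ 0 ≤ q s a y
  upper : ∀ s a y, q s a y ≤ y ⊔ M.Rmax

namespace Admissible

variable {M : MDP S A ν} {q : S → A → ℝ → ℝ}

theorem bddAbove (hq : M.Admissible q) (s : S) (y : ℝ) : BddAbove (range fun a => q s a y) :=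
  ⟨_, forall_mem_range.2 fun a => hq.upper s a y⟩

theorem measurable_extState (hq : M.Admissible q) :
    Measurable fun x : (S × ℝ) × A => q x.1.1 x.2 x.1.2 :=
  hq.measurable.comp (measurable_fst.fst.prodMk (measurable_snd.prodMk measurable_fst.snd))

theorem abs_le (hq : M.Admissible q) (s : S) (a : A) (y : ℝ) : |q s a y| ≤ |y| ⊔ M.Rmax := by
  rw [abs_of_nonneg ((le_max_right _ _).trans (hq.lower s a y))]
  exact (hq.upper s a y).trans (max_le_max (le_abs_self y) le_rfl)

theorem exists_selections [StandardBorelSpace S] [StandardBorelSpace A] [Nonempty A] [SFinite ν]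
    (hq : M.Admissible q) : ∃ g : ℕ → S → A, (∀ i, Measurable (g i)) ∧
      Measurable (fun x : S × ℝ => ⨆ i, q x.1 (g i x.1) x.2) ∧
      ∀ᵐ s ∂ν, ∀ y, ⨆ i, q s (g i s) y = ⨆ a, q s a y := by
  obtain ⟨g, hg, hae⟩ := exists_selections_ae_of_lipschitz ν hq.measurable hq.lipschitz
  refine ⟨g, hg, Measurable.iSup fun i => hq.measurable.comp
    (measurable_fst.prodMk (((hg i).comp measurable_fst).prodMk measurable_snd)), ?_⟩
  filter_upwards [hae] with s hs y
  exact ciSup_comp_eq_of_forall_lt (g := fun i => g i s) (hq.bddAbove s y) (hs y)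

variable [SFinite ν] [StandardBorelSpace S] [StandardBorelSpace A]

theorem inDomain (hq : M.Admissible q) : M.InDomain q :=
  M.inDomain_of_measurable hq.measurable fun Y =>
    ⟨Y ⊔ M.Rmax, fun s a y hy => (hq.abs_le s a y).trans (max_le_max hy le_rfl)⟩

theorem measurable_bellmanOpt [Nonempty A] (hq : M.Admissible q) :
    Measurable fun x : S × A × ℝ => M.bellmanOpt q x.1 x.2.1 x.2.2 := by
  obtain ⟨g, hg, hW, hae⟩ := hq.exists_selections
  have hf : Measurable fun x : (S × A × ℝ) × S => M.nextY x.1.1 x.1.2.1 x.1.2.2 x.2 ⊔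
      ⨆ i, q x.2 (g i x.2) (M.nextY x.1.1 x.1.2.1 x.1.2.2 x.2) :=
    M.measurable_nextY.sup (hW.comp (measurable_snd.prodMk M.measurable_nextY))
  have hI := hf.stronglyMeasurable.integral_kernel_prod_right'
    (κ := M.P.comap (fun x : S × A × ℝ => (x.1, x.2.1))
      (measurable_fst.prodMk measurable_snd.fst))
  convert hI.measurable.const_mul M.γ using 1
  funext x
  rw [bellmanOpt]
  congr 1
  refine integral_congr_ae ?_
  filter_upwards [(M.P_absolutelyContinuous (x.1, x.2.1)).ae_le hae] with s' hs'
  rw [hs']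

/-- The factor `γ` cancels the division by `γ` in `nextY`, which preserves both the Lipschitz
constant 1 and the bounds. -/
theorem bellmanOpt [Nonempty A] (hq : M.Admissible q) : M.Admissible (M.bellmanOpt q) where
  measurable := hq.measurable_bellmanOpt
  lipschitz s a y y' := by
    rw [MDP.bellmanOpt, MDP.bellmanOpt, ← mul_sub, abs_mul, abs_of_pos M.γ_pos]
    have h : |y - y'| = M.γ * (|y - y'| / M.γ) := by rw [mul_div_cancel₀ _ M.γ_pos.ne']
    rw [h]
    refine mul_le_mul_of_nonneg_left ?_ M.γ_pos.le
    refine abs_integral_sub_integral_le (hq.inDomain s a y).2 (hq.inDomain s a y').2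
      (.of_forall fun s' => ?_)
    have hy := M.abs_nextY_sub_le s a y y' s'
    refine (abs_max_sub_max_le_max _ _ _ _).trans (max_le hy ?_)
    exact abs_ciSup_sub_ciSup_le (hq.bddAbove _ _) (hq.bddAbove _ _)
      fun a' => (hq.lipschitz _ _ _ _).trans hy
  lower s a y := by
    have h : (y ⊔ 0) / M.γ ≤ ∫ s', (M.nextY s a y s' ⊔ ⨆ a', q s' a' (M.nextY s a y s'))
        ∂(M.P (s, a)) := by
      have hle := integral_mono (integrable_const (μ := M.P (s, a)) ((y ⊔ 0) / M.γ))
        (hq.inDomain s a y).2 fun s' => by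
          refine le_max_of_le_left (div_le_div_of_nonneg_right ?_ M.γ_pos.le)
          rw [sup_comm]
          exact max_le_max (M.R_nonneg ..) le_rfl
      simpa using hle
    rw [MDP.bellmanOpt]
    rwa [div_le_iff₀' M.γ_pos] at h
  upper s a y := by
    have h : ∫ s', (M.nextY s a y s' ⊔ ⨆ a', q s' a' (M.nextY s a y s')) ∂(M.P (s, a)) ≤
        (y ⊔ M.Rmax) / M.γ := by
      have hle := integral_mono (hq.inDomain s a y).2
        (integrable_const (μ := M.P (s, a)) ((y ⊔ M.Rmax) / M.γ)) fun s' => by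
          have h1 : M.nextY s a y s' ≤ (y ⊔ M.Rmax) / M.γ := by
            refine div_le_div_of_nonneg_right ?_ M.γ_pos.le
            rw [sup_comm]
            exact max_le_max le_rfl (M.R_le ..)
          have h2 : M.Rmax ≤ (y ⊔ M.Rmax) / M.γ := by
            rw [le_div_iff₀ M.γ_pos]
            refine le_max_of_le_right ?_
            exact mul_le_of_le_one_right (M.Rmax_nonneg s a) M.γ_lt_one.le
          exact max_le h1 (ciSup_le fun a' => (hq.upper _ _ _).trans (max_le h1 h2))
      simpa using hle
    rw [MDP.bellmanOpt]
    rwa [le_div_iff₀' M.γ_pos] at h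

end Admissible

open Filter Topology in
/-- Value iteration started at `y ∨ 0` converges to an admissible fixed point. -/
theorem exists_admissible_fixedPoint [SFinite ν] [StandardBorelSpace S] [StandardBorelSpace A]
    [Nonempty A] (M : MDP S A ν) : ∃ V, M.Admissible V ∧ M.bellmanOpt V = V := by
  let Q : ℕ → S → A → ℝ → ℝ := fun n => M.bellmanOpt^[n] fun _ _ y => y ⊔ 0
  have hQsucc : ∀ n, Q (n + 1) = M.bellmanOpt (Q n) := fun n =>
    Function.iterate_succ_apply' _ _ _
  have hQ : ∀ n, M.Admissible (Q n) := by
    intro n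
    induction n with
    | zero =>
      exact ⟨measurable_snd.snd.sup measurable_const, fun s a y y' => by
        simpa [Q] using abs_max_sub_max_le_max y 0 y' 0, fun _ _ _ => le_rfl,
        fun s a y => max_le_max le_rfl (M.Rmax_nonneg s a)⟩
    | succ n ih => exact hQsucc n ▸ ih.bellmanOpt
  -- The iterates are unbounded in `y`, but the first two both lie between `y ∨ 0` and `y ∨ Rmax`,
  -- so their distance is at most `Rmax`.
  have hdist : ∀ n s a y, dist (Q n s a y) (Q (n + 1) s a y) ≤ M.Rmax * M.γ ^ n := by
    intro n
    induction n with
    | zero =>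
      intro s a y
      rw [Real.dist_eq, abs_sub_le_iff]
      have h0 := M.Rmax_nonneg s a
      have h1 := (hQ 1).lower s a y
      have h2 := (hQ 1).upper s a y
      have h3 : Q 0 s a y = y ⊔ 0 := rfl
      have h4 : y ⊔ M.Rmax ≤ y ⊔ 0 + M.Rmax :=
        max_le (by linarith [le_max_left y 0]) (by linarith [le_max_right y 0])
      rw [h3, pow_zero, mul_one, zero_add]
      constructor <;> linarith
    | succ n ih =>
      intro s a y
      rw [hQsucc (n + 1), Real.dist_eq]
      nth_rw 1 [hQsucc n]
      refine ((hQ n).inDomain.abs_bellmanOpt_sub_le (hQ (n + 1)).inDomain ih s a y).trans_eq ?_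
      ring
  have hlim : ∀ s a y, ∃ v, Tendsto (fun n => Q n s a y) atTop (𝓝 v) := fun s a y =>
    cauchySeq_tendsto_of_complete
      (cauchySeq_of_le_geometric M.γ M.Rmax M.γ_lt_one fun n => hdist n s a y)
  choose V hV using hlim
  have hVadm : M.Admissible V :=
    { measurable := measurable_of_tendsto_metrizable (fun n => (hQ n).measurable)
        (tendsto_pi_nhds.2 fun x => hV x.1 x.2.1 x.2.2)
      lipschitz := fun s a y y' => le_of_tendsto' ((hV s a y).sub (hV s a y')).abs
        fun n => (hQ n).lipschitz s a y y'
      lower := fun s a y => ge_of_tendsto' (hV s a y) fun n => (hQ n).lower s a y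
      upper := fun s a y => le_of_tendsto' (hV s a y) fun n => (hQ n).upper s a y }
  refine ⟨V, hVadm, ?_⟩
  funext s a y
  -- Uniformity of this rate lets the operator pass to the limit.
  have hQV : ∀ n s a y, |Q n s a y - V s a y| ≤ M.Rmax * M.γ ^ n / (1 - M.γ) := fun n s a y =>
    dist_le_of_le_geometric_of_tendsto M.γ M.Rmax M.γ_lt_one (fun n => hdist n s a y) (hV s a y) n
  have hg : Tendsto (fun n => M.γ * (M.Rmax * M.γ ^ n / (1 - M.γ))) atTop (𝓝 0) := by
    have h := tendsto_pow_atTop_nhds_zero_of_lt_one M.γ_pos.le M.γ_lt_one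
    simpa using ((h.const_mul M.Rmax).div_const (1 - M.γ)).const_mul M.γ
  have hT : Tendsto (fun n => Q (n + 1) s a y) atTop (𝓝 (M.bellmanOpt V s a y)) := by
    refine tendsto_iff_dist_tendsto_zero.2
      (squeeze_zero (fun _ => dist_nonneg) (fun n => ?_) hg)
    rw [hQsucc n, Real.dist_eq]
    exact (hQ n).inDomain.abs_bellmanOpt_sub_le hVadm.inDomain (hQV n) s a y
  exact tendsto_nhds_unique hT ((tendsto_add_atTop_iff_nat 1).2 (hV s a y))

end MDP

/-! ### One step of the extended process -/

namespace MDP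

variable {S A : Type*} [MeasurableSpace S] [MeasurableSpace A] {ν : Measure S}

section Step

variable [SFinite ν] (M : MDP S A ν) (π : ExtPolicy S A)

theorem extP_apply (z : (S × ℝ) × A) :
    M.extP z = (M.P (z.1.1, z.2)).map fun s' => (s', M.nextY z.1.1 z.2 z.1.2 s') := by
  rw [extP, Kernel.map_apply _ M.measurable_extNext, Kernel.prod_apply, Kernel.id_apply,
    Kernel.comap_apply, Measure.dirac_prod,
    Measure.map_map M.measurable_extNext measurable_prodMk_left]
  rfl

theorem map_fst_step (z : (S × ℝ) × A) : (M.step π z).map Prod.fst = M.extP z := by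
  rw [← Kernel.fst_apply, step, Kernel.fst_compProd]

theorem integral_step_fst (z : (S × ℝ) × A) {f : S × ℝ → ℝ} (hf : Measurable f) :
    ∫ x, f x.1 ∂(M.step π z) =
      ∫ s', f (s', M.nextY z.1.1 z.2 z.1.2 s') ∂(M.P (z.1.1, z.2)) := by
  rw [← integral_map (φ := Prod.fst) measurable_fst.aemeasurable hf.aestronglyMeasurable,
    map_fst_step, extP_apply,
    integral_map (M.measurable_mk_nextY _ _ _).aemeasurable hf.aestronglyMeasurable]

theorem ae_step_of_ae (z : (S × ℝ) × A) {p : S → Prop} (hp : ∀ᵐ s ∂ν, p s) :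
    ∀ᵐ x ∂(M.step π z), p x.1.1 := by
  refine ae_of_ae_map (p := fun x : S × ℝ => p x.1) measurable_fst.aemeasurable ?_
  refine ae_of_ae_map (p := p) measurable_fst.aemeasurable ?_
  rw [map_fst_step, extP_apply, Measure.map_map measurable_fst (M.measurable_mk_nextY _ _ _)]
  change ∀ᵐ s ∂(Measure.map id _), p s
  rw [Measure.map_id]
  exact (M.P_absolutelyContinuous _).ae_le hp

theorem ae_step_nextY (z : (S × ℝ) × A) :
    ∀ᵐ x ∂(M.step π z), x.1.2 = M.nextY z.1.1 z.2 z.1.2 x.1.1 := by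
  refine ae_of_ae_map (p := fun x : S × ℝ => x.2 = M.nextY z.1.1 z.2 z.1.2 x.1)
    measurable_fst.aemeasurable ?_
  have hm : MeasurableSet {x : S × ℝ | x.2 = M.nextY z.1.1 z.2 z.1.2 x.1} :=
    measurableSet_eq_fun measurable_snd ((M.measurable_nextY_right _ _ _).comp measurable_fst)
  rw [map_fst_step, extP_apply, ae_map_iff (M.measurable_mk_nextY _ _ _).aemeasurable hm]
  exact .of_forall fun _ => rfl

theorem ae_step_deterministic [StandardBorelSpace A] {g : S × ℝ → A} (hg : Measurable g)
    (z : (S × ℝ) × A) :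
    ∀ᵐ x ∂(M.step ⟨Kernel.deterministic g hg, inferInstance⟩ z), x.2 = g x.1 := by
  rw [step]
  refine Kernel.ae_compProd_of_ae_ae
    (measurableSet_eq_fun measurable_snd (hg.comp measurable_fst)) (.of_forall fun x => ?_)
  rw [Kernel.comap_apply, Kernel.deterministic_apply]
  rw [ae_dirac_eq]
  rfl

end Step

namespace Admissible

variable [SFinite ν] {M : MDP S A ν} {V : S → A → ℝ → ℝ}

theorem ae_step_abs_le (M : MDP S A ν) (π : ExtPolicy S A) (z : (S × ℝ) × A) :
    ∀ᵐ x ∂(M.step π z), |x.1.2| ≤ (M.Rmax ⊔ |z.1.2|) / M.γ := by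
  filter_upwards [M.ae_step_nextY π z] with x hx
  rw [hx]
  exact M.abs_nextY_le ..

theorem integrable_step (hV : M.Admissible V) (π : ExtPolicy S A) (z : (S × ℝ) × A) :
    Integrable (fun x => V x.1.1 x.2 x.1.2) (M.step π z) := by
  refine Integrable.of_bound hV.measurable_extState.aestronglyMeasurable
    ((M.Rmax ⊔ |z.1.2|) / M.γ ⊔ M.Rmax) ?_
  filter_upwards [ae_step_abs_le M π z] with x hx
  exact (hV.abs_le ..).trans (max_le_max hx le_rfl)

/-- Integrating the supremum over countably many selections against one step of the process gives
the Bellman operator. -/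
theorem integral_step_iSup (hV : M.Admissible V) (π : ExtPolicy S A)
    (z : (S × ℝ) × A) {g : ℕ → S → A}
    (hW : Measurable (fun x : S × ℝ => ⨆ i, V x.1 (g i x.1) x.2))
    (hae : ∀ᵐ s ∂ν, ∀ y, ⨆ i, V s (g i s) y = ⨆ a, V s a y) :
    Integrable (fun x => ⨆ i, V x.1.1 (g i x.1.1) x.1.2) (M.step π z) ∧
    M.γ * ∫ x, (⨆ i, V x.1.1 (g i x.1.1) x.1.2) ∂(M.step π z) =
      M.bellmanOpt V z.1.1 z.2 z.1.2 := by
  constructor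
  · refine Integrable.of_bound (hW.comp measurable_fst).aestronglyMeasurable
      ((M.Rmax ⊔ |z.1.2|) / M.γ ⊔ M.Rmax) ?_
    filter_upwards [ae_step_abs_le M π z] with x hx
    have h (i) := (hV.abs_le x.1.1 (g i x.1.1) x.1.2).trans (max_le_max hx le_rfl)
    refine _root_.abs_le.2 ⟨?_, ciSup_le fun i => (_root_.abs_le.1 (h i)).2⟩
    exact (_root_.abs_le.1 (h 0)).1.trans
      (le_ciSup (f := fun i => V x.1.1 (g i x.1.1) x.1.2)
        ((hV.bddAbove x.1.1 x.1.2).mono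
          (range_comp_subset_range (fun i => g i x.1.1) fun a => V x.1.1 a x.1.2)) 0)
  · rw [M.integral_step_fst π z hW, MDP.bellmanOpt]
    congr 1
    refine integral_congr_ae ?_
    filter_upwards [(M.P_absolutelyContinuous (z.1.1, z.2)).ae_le hae] with s' hs'
    -- The maximum with `y'` is absorbed because `V ≥ y`.
    rw [hs', max_eq_right]
    exact ((le_max_left _ _).trans (hV.lower s' z.2 _)).trans (le_ciSup (hV.bddAbove _ _) z.2)

variable [StandardBorelSpace S] [StandardBorelSpace A]

/-- The action drawn by a policy does no better than the supremum over actions, whose discounted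
average is `V` by the fixed-point equation. -/
theorem gamma_mul_integral_step_le (hV : M.Admissible V) (hfix : M.bellmanOpt V = V)
    (π : ExtPolicy S A) (z : (S × ℝ) × A) :
    M.γ * ∫ x, V x.1.1 x.2 x.1.2 ∂(M.step π z) ≤ V z.1.1 z.2 z.1.2 := by
  have : Nonempty A := ⟨z.2⟩
  obtain ⟨g, -, hW, hae⟩ := hV.exists_selections
  obtain ⟨hint, heq⟩ := hV.integral_step_iSup π z hW hae
  rw [hfix] at heq
  rw [← heq]
  refine mul_le_mul_of_nonneg_left
    (integral_mono_ae (hV.integrable_step π z) hint ?_) M.γ_pos.le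
  filter_upwards [M.ae_step_of_ae π z hae] with x hx
  rw [hx]
  exact le_ciSup (hV.bddAbove _ _) x.2

/-- There is a deterministic stationary policy which loses at most `ε` in every step. -/
theorem exists_greedy [Nonempty A] (hV : M.Admissible V) (hfix : M.bellmanOpt V = V)
    {ε : ℝ} (hε : 0 < ε) : ∃ π : ExtPolicy S A, ∀ z : (S × ℝ) × A,
      V z.1.1 z.2 z.1.2 - ε ≤ M.γ * ∫ x, V x.1.1 x.2 x.1.2 ∂(M.step π z) := by
  obtain ⟨g, hg, hW, hae⟩ := hV.exists_selections
  -- The policy takes the first selection within `ε` of the countable supremum; least indices keep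
  -- the choice measurable.
  let p : ℕ → S × ℝ → Prop := fun i x =>
    (⨆ i, V x.1 (g i x.1) x.2) - ε < V x.1 (g i x.1) x.2
  have hp : ∀ x, ∃ i, p i x := fun x =>
    exists_lt_of_lt_ciSup (f := fun i => V x.1 (g i x.1) x.2) (sub_lt_self _ hε)
  have hpm : ∀ i, MeasurableSet {x | p i x} := fun i =>
    measurableSet_lt (hW.sub_const ε) (hV.measurable.comp
      (measurable_fst.prodMk (((hg i).comp measurable_fst).prodMk measurable_snd)))
  classical
  have hsel : Measurable fun x : S × ℝ => g (Nat.find (hp x)) x.1 :=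
    Measurable.find (f := fun i (x : S × ℝ) => g i x.1) (fun i => (hg i).comp measurable_fst) hpm hp
  refine ⟨⟨Kernel.deterministic _ hsel, inferInstance⟩, fun z => ?_⟩
  set π : ExtPolicy S A := ⟨Kernel.deterministic _ hsel, inferInstance⟩
  obtain ⟨hint, heq⟩ := hV.integral_step_iSup π z hW hae
  rw [hfix] at heq
  have hle : (∫ x, (⨆ i, V x.1.1 (g i x.1.1) x.1.2) ∂(M.step π z)) - ε ≤
      ∫ x, V x.1.1 x.2 x.1.2 ∂(M.step π z) := by
    have h := integral_mono_ae (hint.sub (integrable_const ε)) (hV.integrable_step π z) <| by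
      filter_upwards [M.ae_step_deterministic hsel z] with x hx
      rw [hx]
      exact (Nat.find_spec (hp x.1)).le
    simp only [Pi.sub_apply] at h
    rw [integral_sub hint (integrable_const ε)] at h
    simpa using h
  have h1 := mul_le_mul_of_nonneg_left hle M.γ_pos.le
  rw [mul_sub, heq] at h1
  have h2 : M.γ * ε ≤ ε := mul_le_of_le_one_left hε.le M.γ_lt_one.le
  linarith

end Admissible

/-! ### The trajectory measure -/

section Law

variable [SFinite ν] (M : MDP S A ν) (π : ExtPolicy S A) (z : (S × ℝ) × A)

instance : IsProbabilityMeasure (M.law π z) := by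
  unfold law; infer_instance

theorem map_eval_zero_law : (M.law π z).map (fun ω => ω 0) = Measure.dirac z := by
  have h : (fun ω : ℕ → (S × ℝ) × A => ω 0) =
      (fun h : (i : Finset.Iic 0) → (S × ℝ) × A => h ⟨0, Finset.mem_Iic.2 le_rfl⟩) ∘
        Preorder.frestrictLe (π := fun _ => (S × ℝ) × A) 0 := rfl
  rw [h, ← Measure.map_map (measurable_pi_apply _) (by fun_prop), law,
    Kernel.traj_map_frestrictLe_apply, Kernel.partialTraj_self, Kernel.id_apply,
    Measure.map_dirac' (measurable_pi_apply _)]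

/-- The Markov property: the joint law of two consecutive extended state-action pairs. -/
theorem map_eval_succ_law (n : ℕ) : (M.law π z).map (fun ω => (ω n, ω (n + 1))) =
    ((M.law π z).map fun ω => ω n) ⊗ₘ M.step π := by
  let e : ((i : Finset.Iic n) → (S × ℝ) × A) → (S × ℝ) × A :=
    fun h => h ⟨n, Finset.mem_Iic.2 le_rfl⟩
  have he : Measurable e := measurable_pi_apply _
  have h1 : (fun ω : ℕ → (S × ℝ) × A => (ω n, ω (n + 1))) =
      Prod.map e id ∘ fun ω =>
        (Preorder.frestrictLe (π := fun _ => (S × ℝ) × A) n ω, ω (n + 1)) := rfl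
  have h2 : (fun ω : ℕ → (S × ℝ) × A => ω n) =
      e ∘ Preorder.frestrictLe (π := fun _ => (S × ℝ) × A) n := rfl
  rw [h1, h2, ← Measure.map_map (by fun_prop) (by fun_prop),
    ← Measure.map_map he (by fun_prop), law,
    ← Kernel.partialTraj_compProd_eq_map_traj (Nat.zero_le n),
    Kernel.traj_map_frestrictLe_apply]
  ext s hs
  rw [Measure.map_apply (by fun_prop) hs,
    Measure.compProd_apply ((he.prodMap measurable_id) hs), Measure.compProd_apply hs,
    lintegral_map (Kernel.measurable_kernel_prodMk_left hs) he]
  rfl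

theorem ae_law_eval_zero [StandardBorelSpace S] [StandardBorelSpace A] :
    ∀ᵐ ω ∂(M.law π z), ω 0 = z := by
  refine ae_of_ae_map (f := fun ω : ℕ → (S × ℝ) × A => ω 0) (p := fun x => x = z)
    (measurable_pi_apply 0).aemeasurable ?_
  rw [map_eval_zero_law, ae_dirac_eq]
  rfl

theorem ae_law_nextY : ∀ᵐ ω ∂(M.law π z), ∀ n,
    (ω (n + 1)).1.2 = M.nextY (ω n).1.1 (ω n).2 (ω n).1.2 (ω (n + 1)).1.1 := by
  refine ae_all_iff.2 fun n => ?_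
  refine ae_of_ae_map (f := fun ω : ℕ → (S × ℝ) × A => (ω n, ω (n + 1)))
    (p := fun x => x.2.1.2 = M.nextY x.1.1.1 x.1.2 x.1.1.2 x.2.1.1) (by fun_prop) ?_
  rw [map_eval_succ_law]
  exact Measure.ae_compProd_of_ae_ae
    (measurableSet_eq_fun measurable_snd.fst.snd M.measurable_nextY_pair)
    (.of_forall fun x => M.ae_step_nextY π x)

variable {M π z} in
-- The tower property, by Fubini for the joint law of two consecutive times.
theorem integral_law_succ {v : (S × ℝ) × A → ℝ} (hv : Measurable v) {n : ℕ}
    (hint : Integrable (fun ω => v (ω (n + 1))) (M.law π z)) :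
    Integrable (fun ω => ∫ x, v x ∂(M.step π (ω n))) (M.law π z) ∧
    ∫ ω, v (ω (n + 1)) ∂(M.law π z) = ∫ ω, ∫ x, v x ∂(M.step π (ω n)) ∂(M.law π z) := by
  have hp : Measurable fun ω : ℕ → (S × ℝ) × A => (ω n, ω (n + 1)) := by fun_prop
  have hn : Measurable fun ω : ℕ → (S × ℝ) × A => ω n := measurable_pi_apply n
  have hv2 : Measurable fun x : ((S × ℝ) × A) × ((S × ℝ) × A) => v x.2 := hv.comp measurable_snd
  have hint' : Integrable (fun x => v x.2) (((M.law π z).map fun ω => ω n) ⊗ₘ M.step π) := by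
    rw [← map_eval_succ_law]
    exact (integrable_map_measure hv2.aestronglyMeasurable hp.aemeasurable).2 hint
  have hI : Integrable (fun y => ∫ x, v x ∂(M.step π y)) ((M.law π z).map fun ω => ω n) :=
    Integrable.integral_compProd (κ := Kernel.const Unit _) (η := Kernel.prodMkLeft Unit _)
      (a := ()) hint'
  refine ⟨(integrable_map_measure hI.1 hn.aemeasurable).1 hI, ?_⟩
  have h := Measure.integral_compProd hint'
  rw [← map_eval_succ_law, integral_map hp.aemeasurable hv2.aestronglyMeasurable,
    integral_map hn.aemeasurable hI.1] at h
  exact h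

end Law

/-! ### Pathwise identities for the return -/

section Path

variable (M : MDP S A ν) {ω : ℕ → (S × ℝ) × A}

theorem bddAbove_discounted_reward (ω : ℕ → (S × ℝ) × A) :
    BddAbove (range fun t : ℕ => M.γ ^ t * M.R (ω t).1.1 (ω t).2 (ω (t + 1)).1.1) := by
  refine ⟨M.Rmax, forall_mem_range.2 fun t => ?_⟩
  exact (mul_le_of_le_one_left (M.R_nonneg ..)
    (pow_le_one₀ M.γ_pos.le M.γ_lt_one.le)).trans (M.R_le ..)

theorem maxReturn_nonneg (ω : ℕ → (S × ℝ) × A) : 0 ≤ M.maxReturn ω :=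
  (mul_nonneg (pow_nonneg M.γ_pos.le 0) (M.R_nonneg ..)).trans
    (le_ciSup (M.bddAbove_discounted_reward ω) 0)

theorem maxReturn_le (ω : ℕ → (S × ℝ) × A) : M.maxReturn ω ≤ M.Rmax :=
  ciSup_le fun _ => (mul_le_of_le_one_left (M.R_nonneg ..)
    (pow_le_one₀ M.γ_pos.le M.γ_lt_one.le)).trans (M.R_le ..)

theorem measurable_maxReturn : Measurable M.maxReturn := by
  exact Measurable.iSup fun t => Measurable.const_mul
    (M.measurable_R.comp ((measurable_pi_apply t).fst.fst.prodMk
    ((measurable_pi_apply t).snd.prodMk (measurable_pi_apply (t + 1)).fst.fst))) _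

variable {M}

/-- This is what the division by `γ` in `nextY` is for: after discounting, `y` is a running maximum
of discounted rewards. -/
theorem discounted_succ
    (h : ∀ n, (ω (n + 1)).1.2 = M.nextY (ω n).1.1 (ω n).2 (ω n).1.2 (ω (n + 1)).1.1) (n : ℕ) :
    M.γ ^ (n + 1) * (ω (n + 1)).1.2 =
      M.γ ^ n * M.R (ω n).1.1 (ω n).2 (ω (n + 1)).1.1 ⊔ M.γ ^ n * (ω n).1.2 := by
  rw [h, pow_succ, mul_assoc, gamma_mul_nextY, mul_max_of_nonneg _ _ (pow_nonneg M.γ_pos.le n)]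

theorem monotone_discounted
    (h : ∀ n, (ω (n + 1)).1.2 = M.nextY (ω n).1.1 (ω n).2 (ω n).1.2 (ω (n + 1)).1.1) :
    Monotone fun n => M.γ ^ n * (ω n).1.2 :=
  monotone_nat_of_le_succ fun n => discounted_succ h n ▸ le_max_right _ _

/-- The discounted auxiliary components `γ ^ n * yₙ` have supremum `y₀ ∨ maxReturn`. -/
theorem isLUB_discounted
    (h : ∀ n, (ω (n + 1)).1.2 = M.nextY (ω n).1.1 (ω n).2 (ω n).1.2 (ω (n + 1)).1.1) :
    IsLUB (range fun n => M.γ ^ n * (ω n).1.2) ((ω 0).1.2 ⊔ M.maxReturn ω) := by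
  constructor
  · refine forall_mem_range.2 fun n => ?_
    induction n with
    | zero => simp
    | succ n ih =>
      rw [discounted_succ h]
      exact max_le (le_max_of_le_right (le_ciSup (M.bddAbove_discounted_reward ω) n)) ih
  · intro b hb
    have hb' := forall_mem_range.1 hb
    refine max_le (by simpa using hb' 0) (ciSup_le fun n => le_trans ?_ (hb' (n + 1)))
    rw [discounted_succ h]
    exact le_max_left _ _

theorem abs_discounted_le
    (h : ∀ n, (ω (n + 1)).1.2 = M.nextY (ω n).1.1 (ω n).2 (ω n).1.2 (ω (n + 1)).1.1) (n : ℕ) :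
    |M.γ ^ n * (ω n).1.2| ≤ |(ω 0).1.2| ⊔ M.Rmax := by
  have h1 : (ω 0).1.2 ≤ M.γ ^ n * (ω n).1.2 := by
    simpa using monotone_discounted h (Nat.zero_le n)
  have h2 : M.γ ^ n * (ω n).1.2 ≤ (ω 0).1.2 ⊔ M.maxReturn ω :=
    (isLUB_discounted h).1 (mem_range_self n)
  refine abs_le.2 ⟨?_, h2.trans (max_le_max (le_abs_self _) (M.maxReturn_le ω))⟩
  linarith [neg_abs_le (ω 0).1.2, le_max_left |(ω 0).1.2| M.Rmax]

variable (M) in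
theorem integrable_return [SFinite ν] (π : ExtPolicy S A) (z : (S × ℝ) × A) (y : ℝ) :
    Integrable (fun ω => y ⊔ M.maxReturn ω) (M.law π z) := by
  refine Integrable.of_bound (measurable_const.sup M.measurable_maxReturn).aestronglyMeasurable
    (|y| ⊔ M.Rmax) (.of_forall fun ω => ?_)
  refine abs_max_le_max_abs_abs.trans (max_le_max le_rfl ?_)
  rw [abs_of_nonneg (M.maxReturn_nonneg ω)]
  exact M.maxReturn_le ω

end Path

/-! ### Identification of the fixed point with the optimal value -/

section Optimality

variable [SFinite ν] [StandardBorelSpace S] [StandardBorelSpace A] {M : MDP S A ν}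
  {V : S → A → ℝ → ℝ}

namespace Admissible

/-- Although `yₙ` may grow like `γ⁻ⁿ`, discounting keeps it bounded; this supplies integrability at
each time. -/
theorem ae_law_abs_discounted_le (hV : M.Admissible V) (π : ExtPolicy S A) (z : (S × ℝ) × A)
    (n : ℕ) : ∀ᵐ ω ∂(M.law π z),
      |M.γ ^ n * V (ω n).1.1 (ω n).2 (ω n).1.2| ≤ |z.1.2| ⊔ M.Rmax := by
  filter_upwards [M.ae_law_eval_zero π z, M.ae_law_nextY π z] with ω h0 h
  have hγ := pow_nonneg M.γ_pos.le n
  rw [abs_mul, abs_of_nonneg hγ]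
  refine (mul_le_mul_of_nonneg_left (hV.abs_le _ _ _) hγ).trans ?_
  rw [mul_max_of_nonneg _ _ hγ]
  have h1 := abs_discounted_le h n
  rw [abs_mul, abs_of_nonneg hγ, h0] at h1
  exact max_le h1 (le_max_of_le_right (mul_le_of_le_one_left (M.Rmax_nonneg z.1.1 z.2)
    (pow_le_one₀ M.γ_pos.le M.γ_lt_one.le)))

theorem integrable_law (hV : M.Admissible V) (π : ExtPolicy S A) (z : (S × ℝ) × A) (n : ℕ) :
    Integrable (fun ω => V (ω n).1.1 (ω n).2 (ω n).1.2) (M.law π z) := by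
  have h : Integrable (fun ω => M.γ ^ n * V (ω n).1.1 (ω n).2 (ω n).1.2) (M.law π z) :=
    Integrable.of_bound ((hV.measurable_extState.comp
      (measurable_pi_apply n)).const_mul _).aestronglyMeasurable _
      (hV.ae_law_abs_discounted_le π z n)
  exact (integrable_const_mul_iff (pow_pos M.γ_pos n).ne'.isUnit _).1 h

theorem integral_law_zero (V : S → A → ℝ → ℝ) (π : ExtPolicy S A) (z : (S × ℝ) × A) :
    ∫ ω, V (ω 0).1.1 (ω 0).2 (ω 0).1.2 ∂(M.law π z) = V z.1.1 z.2 z.1.2 := by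
  rw [integral_congr_ae (g := fun _ => V z.1.1 z.2 z.1.2)]
  · simp
  · filter_upwards [M.ae_law_eval_zero π z] with ω h0
    rw [h0]

theorem discounted_integral_law_le (hV : M.Admissible V) (hfix : M.bellmanOpt V = V)
    (π : ExtPolicy S A) (z : (S × ℝ) × A) (n : ℕ) :
    M.γ ^ n * ∫ ω, V (ω n).1.1 (ω n).2 (ω n).1.2 ∂(M.law π z) ≤ V z.1.1 z.2 z.1.2 := by
  induction n with
  | zero => rw [integral_law_zero, pow_zero, one_mul]
  | succ n ih =>
    obtain ⟨hint, heq⟩ := integral_law_succ hV.measurable_extState (hV.integrable_law π z (n + 1))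
    refine le_trans ?_ ih
    rw [heq, pow_succ, mul_assoc, ← integral_const_mul]
    exact mul_le_mul_of_nonneg_left (integral_mono (hint.const_mul _) (hV.integrable_law π z n)
      fun ω => hV.gamma_mul_integral_step_le hfix π (ω n)) (pow_nonneg M.γ_pos.le n)

theorem le_discounted_integral_law (hV : M.Admissible V) {π : ExtPolicy S A} {ε : ℝ}
    (hπ : ∀ z : (S × ℝ) × A,
      V z.1.1 z.2 z.1.2 - ε ≤ M.γ * ∫ x, V x.1.1 x.2 x.1.2 ∂(M.step π z))
    (z : (S × ℝ) × A) (n : ℕ) :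
    V z.1.1 z.2 z.1.2 - ε * ∑ k ∈ Finset.range n, M.γ ^ k ≤
      M.γ ^ n * ∫ ω, V (ω n).1.1 (ω n).2 (ω n).1.2 ∂(M.law π z) := by
  induction n with
  | zero => simp [integral_law_zero]
  | succ n ih =>
    obtain ⟨hint, heq⟩ := integral_law_succ hV.measurable_extState (hV.integrable_law π z (n + 1))
    have h1 : ∫ ω, V (ω n).1.1 (ω n).2 (ω n).1.2 ∂(M.law π z) - ε ≤
        M.γ * ∫ ω, ∫ x, V x.1.1 x.2 x.1.2 ∂(M.step π (ω n)) ∂(M.law π z) := by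
      rw [← integral_const_mul]
      have h := integral_mono ((hV.integrable_law π z n).sub (integrable_const ε))
        (hint.const_mul M.γ) fun ω => hπ (ω n)
      simp only [Pi.sub_apply] at h
      rw [integral_sub (hV.integrable_law π z n) (integrable_const ε)] at h
      simpa using h
    have h2 := mul_le_mul_of_nonneg_left h1 (pow_nonneg M.γ_pos.le n)
    rw [heq, pow_succ, mul_assoc, Finset.sum_range_succ]
    linarith

-- `γ ^ n * yₙ` lies below `γ ^ n * V` at time `n`, whose expectation is at most the initial value;
-- dominated convergence turns the left side into `qPolicy`.
open Filter Topology in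
theorem qPolicy_le (hV : M.Admissible V) (hfix : M.bellmanOpt V = V)
    (π : ExtPolicy S A) (s : S) (a : A) (y : ℝ) : M.qPolicy π s a y ≤ V s a y := by
  have hm : ∀ n, Measurable fun ω : ℕ → (S × ℝ) × A => M.γ ^ n * (ω n).1.2 := fun n =>
    (measurable_pi_apply n).fst.snd.const_mul _
  have hbd : ∀ n, ∀ᵐ ω ∂(M.law π ((s, y), a)), ‖M.γ ^ n * (ω n).1.2‖ ≤ |y| ⊔ M.Rmax := by
    intro n
    filter_upwards [M.ae_law_eval_zero π ((s, y), a), M.ae_law_nextY π ((s, y), a)] with ω h0 h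
    rw [Real.norm_eq_abs]
    simpa only [h0] using abs_discounted_le h n
  have hlim : Tendsto (fun n => ∫ ω, M.γ ^ n * (ω n).1.2 ∂(M.law π ((s, y), a))) atTop
      (𝓝 (M.qPolicy π s a y)) := by
    refine tendsto_integral_of_dominated_convergence (fun _ => |y| ⊔ M.Rmax)
      (fun n => (hm n).aestronglyMeasurable) (integrable_const _) hbd ?_
    filter_upwards [M.ae_law_eval_zero π ((s, y), a), M.ae_law_nextY π ((s, y), a)] with ω h0 h
    have := tendsto_atTop_isLUB (monotone_discounted h) (isLUB_discounted h)
    rwa [h0] at this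
  refine le_of_tendsto' hlim fun n => ?_
  refine le_trans ?_ (hV.discounted_integral_law_le hfix π ((s, y), a) n)
  rw [← integral_const_mul]
  refine integral_mono (Integrable.of_bound (hm n).aestronglyMeasurable _ (hbd n))
    ((hV.integrable_law π _ n).const_mul _) fun ω => ?_
  exact mul_le_mul_of_nonneg_left ((le_max_left _ _).trans (hV.lower _ _ _))
    (pow_nonneg M.γ_pos.le n)

-- The upper bound on `V` leaves at time `n` at most the full return plus `γ ^ n * Rmax`, which
-- vanishes; the losses per step sum to at most `ε / (1 - γ)`.
open Filter Topology in
theorem sub_le_qPolicy (hV : M.Admissible V) {π : ExtPolicy S A} {ε : ℝ} (hε : 0 ≤ ε)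
    (hπ : ∀ z : (S × ℝ) × A,
      V z.1.1 z.2 z.1.2 - ε ≤ M.γ * ∫ x, V x.1.1 x.2 x.1.2 ∂(M.step π z))
    (s : S) (a : A) (y : ℝ) : V s a y - ε * (1 - M.γ)⁻¹ ≤ M.qPolicy π s a y := by
  have hlim : Tendsto (fun n => M.qPolicy π s a y + M.γ ^ n * M.Rmax) atTop
      (𝓝 (M.qPolicy π s a y)) := by
    have h := tendsto_pow_atTop_nhds_zero_of_lt_one M.γ_pos.le M.γ_lt_one
    simpa using (h.mul_const M.Rmax).const_add (M.qPolicy π s a y)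
  refine ge_of_tendsto' hlim fun n => ?_
  have hgeom : ∑ k ∈ Finset.range n, M.γ ^ k ≤ (1 - M.γ)⁻¹ := by
    rw [← tsum_geometric_of_lt_one M.γ_pos.le M.γ_lt_one]
    exact (summable_geometric_of_lt_one M.γ_pos.le M.γ_lt_one).sum_le_tsum _
      fun k _ => pow_nonneg M.γ_pos.le k
  have h1 := hV.le_discounted_integral_law hπ ((s, y), a) n
  have h2 : M.γ ^ n * ∫ ω, V (ω n).1.1 (ω n).2 (ω n).1.2 ∂(M.law π ((s, y), a)) ≤
      M.qPolicy π s a y + M.γ ^ n * M.Rmax := by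
    rw [← integral_const_mul]
    have h := integral_mono_ae ((hV.integrable_law π ((s, y), a) n).const_mul (M.γ ^ n))
      ((M.integrable_return π ((s, y), a) y).add (integrable_const (M.γ ^ n * M.Rmax))) <| by
        filter_upwards [M.ae_law_eval_zero π ((s, y), a), M.ae_law_nextY π ((s, y), a)]
          with ω h0 hω
        have hlub : M.γ ^ n * (ω n).1.2 ≤ (ω 0).1.2 ⊔ M.maxReturn ω :=
          (isLUB_discounted hω).1 (mem_range_self n)
        rw [h0] at hlub
        have hγ := pow_nonneg M.γ_pos.le n
        have hR := mul_nonneg hγ (M.Rmax_nonneg s a)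
        have h3 := mul_le_mul_of_nonneg_left (hV.upper (ω n).1.1 (ω n).2 (ω n).1.2) hγ
        rw [mul_max_of_nonneg _ _ hγ] at h3
        have h4 : 0 ≤ y ⊔ M.maxReturn ω := le_max_of_le_right (M.maxReturn_nonneg ω)
        refine h3.trans (max_le ?_ ?_)
        · simp only [Pi.add_apply]
          linarith
        · simp only [Pi.add_apply]
          linarith
    simp only [Pi.add_apply] at h
    rw [integral_add (M.integrable_return π ((s, y), a) y) (integrable_const _)] at h
    simpa [qPolicy] using h
  have h3 := mul_le_mul_of_nonneg_left hgeom hε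
  simp only at h1
  linarith

theorem isLUB_qPolicy [Nonempty A] (hV : M.Admissible V) (hfix : M.bellmanOpt V = V)
    (s : S) (a : A) (y : ℝ) :
    IsLUB (range fun π : ExtPolicy S A => M.qPolicy π s a y) (V s a y) := by
  refine ⟨forall_mem_range.2 fun π => hV.qPolicy_le hfix π s a y, fun b hb => ?_⟩
  refine le_of_forall_pos_le_add fun δ hδ => ?_
  have hγ : 0 < 1 - M.γ := sub_pos.2 M.γ_lt_one
  -- The tolerance `δ * (1 - γ)` per step makes the total loss at most `δ`.
  obtain ⟨π, hπ⟩ := hV.exists_greedy hfix (mul_pos hδ hγ)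
  have h := hV.sub_le_qPolicy (mul_pos hδ hγ).le hπ s a y
  rw [mul_assoc, mul_inv_cancel₀ hγ.ne', mul_one] at h
  linarith [hb (mem_range_self π)]

theorem qStar_eq [Nonempty A] (hV : M.Admissible V) (hfix : M.bellmanOpt V = V) :
    M.qStar = V := by
  have : Nonempty (ExtPolicy S A) :=
    ⟨⟨Kernel.const _ (Measure.dirac (Classical.arbitrary A)), inferInstance⟩⟩
  funext s a y
  exact (hV.isLUB_qPolicy hfix s a y).ciSup_eq

end Admissible

end Optimality

end MDP

theorem theorem2 {S A : Type*} [MeasurableSpace S] [StandardBorelSpace S]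
    [MeasurableSpace A] [StandardBorelSpace A] (ν : Measure S) [SigmaFinite ν] (M : MDP S A ν) :
    -- the operator is defined at every measurable function that is bounded for bounded `y`
    (∀ q : S → A → ℝ → ℝ, Measurable (fun x : S × A × ℝ => q x.1 x.2.1 x.2.2) →
      (∀ Y : ℝ, ∃ C : ℝ, ∀ s a y, |y| ≤ Y → |q s a y| ≤ C) → M.InDomain q) ∧
    -- it is a `γ`-contraction with respect to the supremum norm
    (∀ q z : S → A → ℝ → ℝ, M.InDomain q → M.InDomain z →
      supDist (M.bellmanOpt q) (M.bellmanOpt z) ≤ ENNReal.ofReal M.γ * supDist q z) ∧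
    -- the optimal value function is a genuine supremum over extended policies
    (∀ s a y, IsLUB (range fun π : MDP.ExtPolicy S A => M.qPolicy π s a y) (M.qStar s a y)) ∧
    -- it is a fixed point
    (M.InDomain M.qStar ∧ M.bellmanOpt M.qStar = M.qStar) ∧
    -- and the only one at finite distance from it
    (∀ q : S → A → ℝ → ℝ, M.InDomain q → M.bellmanOpt q = q → supDist q M.qStar < ⊤ →
      q = M.qStar) := by
  refine ⟨fun q hq hb => M.inDomain_of_measurable hq hb,
    fun q z hq hz => hq.supDist_bellmanOpt_le hz, ?_⟩
  -- Without actions there are no points `(s, a, y)`, so these claims are vacuous or equate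
  -- functions on an empty domain.
  rcases isEmpty_or_nonempty A with hA | hA
  · refine ⟨fun s a => isEmptyElim a, ⟨fun s a => isEmptyElim a, ?_⟩, fun q _ _ _ => ?_⟩ <;>
      exact funext fun s => funext fun a => isEmptyElim a
  obtain ⟨V, hV, hfix⟩ := M.exists_admissible_fixedPoint
  rw [hV.qStar_eq hfix]
  exact ⟨hV.isLUB_qPolicy hfix, ⟨hV.inDomain, hfix⟩,
    fun q hq hqT h => hq.eq_of_bellmanOpt_eq hV.inDomain hqT hfix h⟩
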